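/- Let $n\ge 2$, and grade the polynomial ring $R=\mathbb{C}[\bar\xi_1,\dots,\bar\xi_{n-1}]$ by $\deg\bar\xi_k=2$ for every $k$. Put $\bar\xi_0=\bar\xi_n=0$, and let $\check J\subseteq R$ be the ideal generated by the polynomials $$f_k=\bar\xi_k\left(\bar\xi_k-\tfrac12\bar\xi_{k-1}-\tfrac12\bar\xi_{k+1}\right),\qquad k=1,\dots,n-1,$$ each of which is homogeneous of degree $4$. Then $R/\check J$, with the grading induced from $R$, is a graded $\mathbb{C}$-algebra with finite-dimensional graded pieces, and its Hilbert series is $$F(R/\check J,s):=\sum_{i\ge 0}\dim_{\mathbb{C}}\big((R/\check J)^i\big)\,s^i=(1+s^2)^{n-1}.$$ Moreover (equivalently), $f_1,\dots,f_{n-1}$ is a regular sequence in $R$: the ideal $\check J$ is proper, and for each $1\le k\le n-1$ the class of $f_k$ is a non-zero-divisor in $R/(f_1,\dots,f_{k-1})$. -/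

import Mathlib

open MvPolynomial
open scoped PowerSeries

noncomputable section

namespace Peterson

/-- The Hilbert series `∑ i, (dim_ℂ A^i) s^i` of a family `𝒜 i = A^i` of subspaces of `A`
(used for gradings with finite-dimensional pieces). -/
def hilbertSeries {A : Type*} [AddCommGroup A] [Module ℂ A] (𝒜 : ℕ → Submodule ℂ A) : ℤ⟦X⟧ :=
  PowerSeries.mk fun i => (Module.finrank ℂ (𝒜 i) : ℤ)

/-- The polynomial ring `ℂ[ξ₁, …, ξₙ₋₁]`; the variable `ξₖ` is `X ⟨k - 1, _⟩`. -/
abbrev PolyRing (n : ℕ) : Type := MvPolynomial (Fin (n - 1)) ℂ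

/-- `ξₖ` for `1 ≤ k ≤ n - 1`, and `0` otherwise; in particular `ξ₀ = ξₙ = 0`. -/
def xi (n k : ℕ) : PolyRing n :=
  if h : 1 ≤ k ∧ k ≤ n - 1 then X ⟨k - 1, by omega⟩ else 0

/-- The quadratic `ξₖ (ξₖ - ½ ξₖ₋₁ - ½ ξₖ₊₁)`, for `1 ≤ k ≤ n - 1`. -/
def quad (n k : ℕ) : PolyRing n :=
  xi n k * (xi n k - C (1 / 2) * xi n (k - 1) - C (1 / 2) * xi n (k + 1))

/-- The sequence `quad n 1, …, quad n (n - 1)`. -/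
def quadSeq (n : ℕ) : List (PolyRing n) :=
  List.ofFn fun i : Fin (n - 1) => quad n (i + 1)

/-- The ideal generated by `quad n 1, …, quad n (n - 1)`. -/
def idealJ (n : ℕ) : Ideal (PolyRing n) :=
  Ideal.span (quad n '' Set.Icc 1 (n - 1))

/-- The degree in which every variable `ξₖ` is placed, namely `2`. -/
def xiDegree (n : ℕ) : Fin (n - 1) → ℕ := fun _ => 2

/-- The degree `i` piece of `ℂ[ξ₁, …, ξₙ₋₁] / J`: the classes of the homogeneous polynomials
of degree `i`, where `deg ξₖ = 2`. -/
def quotientPiece (n i : ℕ) : Submodule ℂ (PolyRing n ⧸ idealJ n) :=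
  (weightedHomogeneousSubmodule ℂ (xiDegree n) i).map
    (Ideal.Quotient.mkₐ ℂ (idealJ n)).toLinearMap

end Peterson

end

/-! Write `I_k = (f_1, …, f_k)`. Up to a unit, `f_{k+1}` is `ξ_{k+1} · g` with `g = ξ_{k+2} - (2
ξ_{k+1} - ξ_k)`. Regularity of the `f_k` follows from a stronger induction,
`regularMod_partialIdeal_xi_sub`: for every `j`, the form `ξ_{k+1} - (j/(j+1)) ξ_k` is regular
modulo `I_k`. By `RegularMod.sup_span_mul`, passing to `I_{k+1}` splits into two cases. Modulo
`(I_k, ξ_{k+1})` the new form is a fresh variable. Modulo `(I_k, g)` one substitutes `ξ_{k+2} = 2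
ξ_{k+1} - ξ_k`, which turns the form for `j` into a unit multiple of the form for `j + 1` one level
down. For the Hilbert series, each regular element of degree `d` contributes a factor `1 - s^d`. The
quadratics give `(1 - s^4)^(n-1) F(R)`. The variables give `(1 - s^2)^(n-1) F(R) = 1`, because the
quotient by them is `ℂ`. Comparing the two avoids computing `F(R)`. -/

namespace Peterson

section Ideals

variable {A : Type*} [CommRing A]

/-- `f` is a nonzerodivisor modulo `I`. -/
def RegularMod (I : Ideal A) (f : A) : Prop := ∀ p, f * p ∈ I → p ∈ I

lemma span_image_Iio_succ (F : ℕ → A) (r : ℕ) :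
    Ideal.span (F '' Set.Iio (r + 1)) = Ideal.span (F '' Set.Iio r) ⊔ Ideal.span {F r} := by
  rw [← Ideal.span_union, ← Set.image_singleton, ← Set.image_union]
  congr 2
  ext k
  simp [le_iff_lt_or_eq]

end Ideals

/-! ### Gradings and Hilbert series of quotients by homogeneous ideals. -/

section Graded

variable {A : Type*} [CommRing A] [Algebra ℂ A] (𝒜 : ℕ → Submodule ℂ A)

/-- The image of the family `𝒜` in the quotient by `I`. -/
def quotientGrading (I : Ideal A) (i : ℕ) : Submodule ℂ (A ⧸ I) :=
  (𝒜 i).map (Ideal.Quotient.mkₐ ℂ I).toLinearMap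

lemma mk_mem_quotientGrading {I : Ideal A} {i : ℕ} {a : A} (ha : a ∈ 𝒜 i) :
    Ideal.Quotient.mk I a ∈ quotientGrading 𝒜 I i :=
  Submodule.mem_map_of_mem (f := (Ideal.Quotient.mkₐ ℂ I).toLinearMap) ha

/-- The degree `i` part of the quotient map. -/
def quotientGradingMap (I : Ideal A) (i : ℕ) : 𝒜 i →+ quotientGrading 𝒜 I i where
  toFun a := ⟨Ideal.Quotient.mk I a, mk_mem_quotientGrading 𝒜 a.2⟩
  map_zero' := by ext; simp
  map_add' a b := by ext; simp

lemma quotientGradingMap_surjective (I : Ideal A) (i : ℕ) :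
    Function.Surjective (quotientGradingMap 𝒜 I i) := by
  rintro ⟨_, a, ha, rfl⟩
  exact ⟨⟨a, ha⟩, rfl⟩

lemma coe_map_quotientGradingMap (I : Ideal A) (y : DirectSum ℕ fun i => 𝒜 i) :
    DirectSum.coeAddMonoidHom (quotientGrading 𝒜 I)
        (DirectSum.map (quotientGradingMap 𝒜 I) y) =
      Ideal.Quotient.mk I (DirectSum.coeAddMonoidHom 𝒜 y) := by
  induction y using DirectSum.induction_on with
  | zero => simp
  | of i x =>
    rw [DirectSum.map_of, DirectSum.coeAddMonoidHom_of, DirectSum.coeAddMonoidHom_of]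
    rfl
  | add x y hx hy => simp only [map_add, hx, hy]

lemma finrank_quotientGrading_add [∀ i, Module.Finite ℂ (𝒜 i)] (I : Ideal A) (i : ℕ) :
    Module.finrank ℂ (quotientGrading 𝒜 I i) +
      Module.finrank ℂ ↥(𝒜 i ⊓ I.restrictScalars ℂ) = Module.finrank ℂ (𝒜 i) := by
  have h := ((Ideal.Quotient.mkₐ ℂ I).toLinearMap.domRestrict
    (𝒜 i)).finrank_range_add_finrank_ker
  rw [LinearMap.range_domRestrict, LinearMap.ker_domRestrict] at h
  have hker : I.restrictScalars ℂ = LinearMap.ker (Ideal.Quotient.mkₐ ℂ I).toLinearMap := by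
    ext x
    simp [Ideal.Quotient.eq_zero_iff_mem]
  rw [← h, (Submodule.equivSubtypeMap (𝒜 i) _).finrank_eq, Submodule.map_comap_subtype, hker]
  rfl

variable [GradedAlgebra 𝒜]

lemma isInternal_quotientGrading {I : Ideal A} (hI : I.IsHomogeneous 𝒜) :
    DirectSum.IsInternal (quotientGrading 𝒜 I) := by
  have hsurj := (DirectSum.map_surjective (quotientGradingMap 𝒜 I)).2
    (quotientGradingMap_surjective 𝒜 I)
  constructor
  · rw [injective_iff_map_eq_zero]
    intro x hx
    obtain ⟨y, rfl⟩ := hsurj x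
    rw [coe_map_quotientGradingMap, Ideal.Quotient.eq_zero_iff_mem] at hx
    ext i
    have h := hI i hx
    have hy : DirectSum.decompose 𝒜 (DirectSum.coeAddMonoidHom 𝒜 y) = y :=
      DirectSum.Decomposition.right_inv y
    rw [hy] at h
    simpa [quotientGradingMap] using Ideal.Quotient.eq_zero_iff_mem.2 h
  · intro z
    obtain ⟨a, rfl⟩ := Ideal.Quotient.mk_surjective z
    refine ⟨DirectSum.map (quotientGradingMap 𝒜 I) (DirectSum.decompose 𝒜 a), ?_⟩
    rw [coe_map_quotientGradingMap]
    congr 1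
    exact DirectSum.Decomposition.left_inv a

lemma nonempty_gradedAlgebra_quotientGrading {I : Ideal A} (hI : I.IsHomogeneous 𝒜) :
    Nonempty (GradedAlgebra (quotientGrading 𝒜 I)) := by
  have hmon : SetLike.GradedMonoid (quotientGrading 𝒜 I) :=
    { one_mem := by
        simpa using mk_mem_quotientGrading 𝒜 (I := I) (SetLike.GradedOne.one_mem (A := 𝒜))
      mul_mem := by
        rintro i j _ _ ⟨a, ha, rfl⟩ ⟨b, hb, rfl⟩
        have := mk_mem_quotientGrading 𝒜 (I := I) (SetLike.GradedMul.mul_mem ha hb)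
        rw [map_mul] at this
        exact this }
  exact ⟨{ hmon, (isInternal_quotientGrading 𝒜 hI).chooseDecomposition with }⟩

/-- Taking the component of degree `i + d` in `x = u + r f` replaces `r` by its degree `i` component
and keeps `u` in the homogeneous ideal `I`. -/
lemma mem_sup_span_singleton_iff_of_mem {I : Ideal A} (hI : I.IsHomogeneous 𝒜) {d i : ℕ}
    {f x : A} (hf : f ∈ 𝒜 d) (hx : x ∈ 𝒜 (i + d)) :
    x ∈ I ⊔ Ideal.span {f} ↔ ∃ u ∈ 𝒜 (i + d), u ∈ I ∧ ∃ r ∈ 𝒜 i, u + f * r = x := by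
  constructor
  · intro h
    obtain ⟨u, hu, v, hv, rfl⟩ := Submodule.mem_sup.1 h
    obtain ⟨r, rfl⟩ := Ideal.mem_span_singleton'.1 hv
    refine ⟨_, (DirectSum.decompose 𝒜 u (i + d)).2, hI _ hu, _,
      (DirectSum.decompose 𝒜 r i).2, ?_⟩
    have h1 := DirectSum.decompose_of_mem_same 𝒜 hx
    rw [DirectSum.decompose_add, DirectSum.add_apply, Submodule.coe_add,
      DirectSum.coe_decompose_mul_add_of_right_mem 𝒜 hf] at h1
    rw [mul_comm f]
    exact h1
  · rintro ⟨u, -, hu, r, -, rfl⟩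
    exact add_mem (Ideal.mem_sup_left hu)
      (Ideal.mem_sup_right (Ideal.mul_mem_right _ _ (Ideal.mem_span_singleton_self f)))

lemma mem_sup_span_singleton_iff_of_lt {I : Ideal A} (hI : I.IsHomogeneous 𝒜) {d i : ℕ}
    {f x : A} (hf : f ∈ 𝒜 d) (hx : x ∈ 𝒜 i) (hid : i < d) :
    x ∈ I ⊔ Ideal.span {f} ↔ x ∈ I := by
  refine ⟨fun h => ?_, fun h => Ideal.mem_sup_left h⟩
  obtain ⟨u, hu, v, hv, rfl⟩ := Submodule.mem_sup.1 h
  obtain ⟨r, rfl⟩ := Ideal.mem_span_singleton'.1 hv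
  have h1 := DirectSum.decompose_of_mem_same 𝒜 hx
  rw [DirectSum.decompose_add, DirectSum.add_apply, Submodule.coe_add,
    DirectSum.coe_decompose_mul_of_right_mem_of_not_le 𝒜 hf (by omega), add_zero] at h1
  rw [← h1]
  exact hI _ hu

/-- In degree `i + d` the enlarged ideal is `I_{i+d} + f A_i`, and regularity says that the two
summands meet in `f I_i`. Multiplication by `f` preserves dimensions, so the count follows from the
dimension formula for a sum. -/
lemma finrank_quotientGrading_sup [∀ i, Module.Finite ℂ (𝒜 i)] [IsDomain A] {I : Ideal A} (hI : I.IsHomogeneous 𝒜)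
    {d : ℕ} {f : A} (hf : f ∈ 𝒜 d) (hf0 : f ≠ 0) (hreg : RegularMod I f) (i : ℕ) :
    Module.finrank ℂ (quotientGrading 𝒜 (I ⊔ Ideal.span {f}) (i + d)) +
      Module.finrank ℂ (quotientGrading 𝒜 I i) =
        Module.finrank ℂ (quotientGrading 𝒜 I (i + d)) := by
  have e1 := finrank_quotientGrading_add 𝒜 I i
  have e2 := finrank_quotientGrading_add 𝒜 I (i + d)
  have e3 := finrank_quotientGrading_add 𝒜 (I ⊔ Ideal.span {f}) (i + d)
  have hinj : Function.Injective (LinearMap.mulLeft ℂ f) := fun a b h =>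
    mul_left_cancel₀ hf0 h
  have hmul {a : A} (ha : a ∈ 𝒜 i) : f * a ∈ 𝒜 (i + d) := by
    rw [mul_comm]
    exact SetLike.GradedMul.mul_mem ha hf
  have hsup : 𝒜 (i + d) ⊓ (I ⊔ Ideal.span {f}).restrictScalars ℂ =
      (𝒜 (i + d) ⊓ I.restrictScalars ℂ) ⊔ (𝒜 i).map (LinearMap.mulLeft ℂ f) := by
    ext x
    simp only [Submodule.mem_inf, Submodule.restrictScalars_mem, Submodule.mem_sup,
      Submodule.mem_map, LinearMap.mulLeft_apply]
    constructor
    · rintro ⟨hx, h⟩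
      obtain ⟨u, hu, huI, r, hr, rfl⟩ := (mem_sup_span_singleton_iff_of_mem 𝒜 hI hf hx).1
        (Submodule.mem_sup.2 h)
      exact ⟨u, ⟨hu, huI⟩, _, ⟨r, hr, rfl⟩, rfl⟩
    · rintro ⟨u, ⟨hu, huI⟩, _, ⟨r, hr, rfl⟩, rfl⟩
      have hx := add_mem hu (hmul hr)
      exact ⟨hx, Submodule.mem_sup.1 ((mem_sup_span_singleton_iff_of_mem 𝒜 hI hf hx).2
        ⟨u, hu, huI, r, hr, rfl⟩)⟩
  have hinf : (𝒜 (i + d) ⊓ I.restrictScalars ℂ) ⊓ (𝒜 i).map (LinearMap.mulLeft ℂ f) =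
      (𝒜 i ⊓ I.restrictScalars ℂ).map (LinearMap.mulLeft ℂ f) := by
    ext x
    simp only [Submodule.mem_inf, Submodule.restrictScalars_mem,
      Submodule.mem_map, LinearMap.mulLeft_apply]
    constructor
    · rintro ⟨⟨-, hx⟩, r, hr, rfl⟩
      exact ⟨r, ⟨hr, hreg r hx⟩, rfl⟩
    · rintro ⟨r, ⟨hr, hrI⟩, rfl⟩
      exact ⟨⟨hmul hr, I.mul_mem_left _ hrI⟩, r, hr, rfl⟩
  have hdim := Submodule.finrank_sup_add_finrank_inf_eq (𝒜 (i + d) ⊓ I.restrictScalars ℂ)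
    ((𝒜 i).map (LinearMap.mulLeft ℂ f))
  rw [← hsup, hinf, ← (Submodule.equivMapOfInjective _ hinj _).finrank_eq,
    ← (Submodule.equivMapOfInjective _ hinj _).finrank_eq] at hdim
  omega

lemma finrank_quotientGrading_sup_of_lt [∀ i, Module.Finite ℂ (𝒜 i)] {I : Ideal A} (hI : I.IsHomogeneous 𝒜)
    {d : ℕ} {f : A} (hf : f ∈ 𝒜 d) {i : ℕ} (hid : i < d) :
    Module.finrank ℂ (quotientGrading 𝒜 (I ⊔ Ideal.span {f}) i) =
      Module.finrank ℂ (quotientGrading 𝒜 I i) := by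
  have e1 := finrank_quotientGrading_add 𝒜 I i
  have e2 := finrank_quotientGrading_add 𝒜 (I ⊔ Ideal.span {f}) i
  have hV : 𝒜 i ⊓ (I ⊔ Ideal.span {f}).restrictScalars ℂ = 𝒜 i ⊓ I.restrictScalars ℂ := by
    ext x
    simp only [Submodule.mem_inf, Submodule.restrictScalars_mem]
    exact and_congr_right fun hx => mem_sup_span_singleton_iff_of_lt 𝒜 hI hf hx hid
  rw [hV] at e2
  omega

lemma hilbertSeries_quotientGrading_sup [∀ i, Module.Finite ℂ (𝒜 i)] [IsDomain A] {I : Ideal A} (hI : I.IsHomogeneous 𝒜)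
    {d : ℕ} {f : A} (hf : f ∈ 𝒜 d) (hf0 : f ≠ 0) (hreg : RegularMod I f) :
    hilbertSeries (quotientGrading 𝒜 (I ⊔ Ideal.span {f})) =
      (1 - PowerSeries.X ^ d) * hilbertSeries (quotientGrading 𝒜 I) := by
  ext i
  rw [sub_mul, one_mul, map_sub, PowerSeries.coeff_X_pow_mul']
  simp only [hilbertSeries, PowerSeries.coeff_mk]
  split_ifs with h
  · obtain ⟨j, rfl⟩ := Nat.exists_eq_add_of_le' h
    have := finrank_quotientGrading_sup 𝒜 hI hf hf0 hreg j
    rw [Nat.add_sub_cancel]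
    omega
  · rw [finrank_quotientGrading_sup_of_lt 𝒜 hI hf (not_le.1 h), sub_zero]

lemma isHomogeneous_span_image_Iio {F : ℕ → A} {d r : ℕ} (hF : ∀ k < r, F k ∈ 𝒜 d) :
    (Ideal.span (F '' Set.Iio r)).IsHomogeneous 𝒜 := by
  apply Ideal.homogeneous_span
  rintro _ ⟨k, hk, rfl⟩
  exact ⟨d, hF k hk⟩

/-- The Hilbert series of a quotient by a regular sequence of elements of degree `d`. -/
theorem hilbertSeries_quotientGrading_span [∀ i, Module.Finite ℂ (𝒜 i)] [IsDomain A] {F : ℕ → A} {d r : ℕ}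
    (hF : ∀ k < r, F k ∈ 𝒜 d) (hF0 : ∀ k < r, F k ≠ 0)
    (hreg : ∀ k < r, RegularMod (Ideal.span (F '' Set.Iio k)) (F k)) :
    hilbertSeries (quotientGrading 𝒜 (Ideal.span (F '' Set.Iio r))) =
      (1 - PowerSeries.X ^ d) ^ r * hilbertSeries (quotientGrading 𝒜 ⊥) := by
  induction r with
  | zero =>
    have h : F '' Set.Iio 0 = ∅ := by simp
    rw [h, Ideal.span_empty, pow_zero, one_mul]
  | succ r ih =>
    rw [span_image_Iio_succ, hilbertSeries_quotientGrading_sup 𝒜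
      (isHomogeneous_span_image_Iio 𝒜 fun k hk => hF k (by omega)) (hF r (by omega))
      (hF0 r (by omega)) (hreg r (by omega)),
      ih (fun k hk => hF k (by omega)) (fun k hk => hF0 k (by omega))
        (fun k hk => hreg k (by omega)), pow_succ']
    ring

end Graded

/-! ### Regularity modulo an ideal, and endomorphisms that eliminate a linear form. -/

section Retraction

variable {A : Type*} [CommRing A]

lemma RegularMod.mul {I : Ideal A} {f g : A} (hf : RegularMod I f) (hg : RegularMod I g) :
    RegularMod I (f * g) := fun p hp => hg p (hf _ (by rwa [← mul_assoc]))

lemma RegularMod.of_sub_unit_mul_mem {I : Ideal A} {f g u : A} (hu : IsUnit u)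
    (h : g - u * f ∈ I) (hf : RegularMod I f) : RegularMod I g := by
  intro p hp
  obtain ⟨v, hv⟩ := hu.exists_left_inv
  apply hf
  have h1 : f * p = v * (g * p - (g - u * f) * p) := by
    linear_combination (-f * p) * hv
  rw [h1]
  exact I.mul_mem_left _ (sub_mem hp (I.mul_mem_right _ h))

lemma RegularMod.ne_zero {I : Ideal A} {f : A} (hf : RegularMod I f) (hI : I ≠ ⊤) : f ≠ 0 := by
  rintro rfl
  exact hI ((Ideal.eq_top_iff_one I).2 (hf 1 (by simp)))

/-- If `y` is regular modulo `(I, x)` and modulo `(I, g)`, and `x` is regular modulo `I`,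
then `y` is regular modulo `(I, x * g)`. -/
lemma RegularMod.sup_span_mul {I : Ideal A} {x g y : A} (hx : RegularMod I x)
    (hyx : RegularMod (I ⊔ Ideal.span {x}) y) (hyg : RegularMod (I ⊔ Ideal.span {g}) y) :
    RegularMod (I ⊔ Ideal.span {x * g}) y := by
  intro p hp
  have hle : I ⊔ Ideal.span {x * g} ≤ I ⊔ Ideal.span {x} :=
    sup_le_sup_left (Ideal.span_singleton_le_span_singleton.2 (dvd_mul_right x g)) I
  obtain ⟨u, hu, v, hv, rfl⟩ := Submodule.mem_sup.1 (hyx p (hle hp))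
  obtain ⟨q, rfl⟩ := Ideal.mem_span_singleton.1 hv
  obtain ⟨w, hw, z, hz, hwz⟩ := Submodule.mem_sup.1 hp
  obtain ⟨r, rfl⟩ := Ideal.mem_span_singleton.1 hz
  -- Cancelling `x` reduces the question about `x * g` to one about `g` alone.
  have h1 : y * q - g * r ∈ I := by
    apply hx
    have : x * (y * q - g * r) = w - y * u := by linear_combination -hwz
    rw [this]
    exact sub_mem hw (I.mul_mem_left _ hu)
  have h2 : q ∈ I ⊔ Ideal.span {g} := by
    apply hyg
    rw [← sub_add_cancel (y * q) (g * r)]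
    exact add_mem (Ideal.mem_sup_left h1) (Ideal.mem_sup_right
      (Ideal.mul_mem_right _ _ (Ideal.mem_span_singleton_self g)))
  obtain ⟨a, ha, b, hb, rfl⟩ := Submodule.mem_sup.1 h2
  obtain ⟨c, rfl⟩ := Ideal.mem_span_singleton.1 hb
  have h3 : u + x * (a + g * c) = (u + x * a) + x * g * c := by ring
  rw [h3]
  exact add_mem (Ideal.mem_sup_left (add_mem hu (I.mul_mem_left _ ha)))
    (Ideal.mem_sup_right (Ideal.mul_mem_right _ _ (Ideal.mem_span_singleton_self _)))

/-- The difference `a - φ a` obeys a twisted Leibniz rule, `a x - φ a φ x = (a - φ a) x + φ a (x - φ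
x)`, so the quotient by `L` can be kept inside the ideal. -/
lemma exists_mem_span_sub_map_eq {φ : A →+* A} {L : A} {G : Set A}
    (hφ : ∀ a, L ∣ a - φ a) (hG : ∀ g ∈ G, φ g = g) {x : A} (hx : x ∈ Ideal.span G) :
    ∃ y ∈ Ideal.span G, x - φ x = L * y := by
  induction hx using Submodule.span_induction with
  | mem g hg => exact ⟨0, zero_mem _, by simp [hG g hg]⟩
  | zero => exact ⟨0, zero_mem _, by simp⟩
  | add x y _ _ hx hy =>
    obtain ⟨u, hu, hu'⟩ := hx
    obtain ⟨v, hv, hv'⟩ := hy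
    exact ⟨u + v, add_mem hu hv, by rw [map_add]; linear_combination hu' + hv'⟩
  | smul a x hx' hx =>
    obtain ⟨u, hu, hu'⟩ := hx
    obtain ⟨b, hb⟩ := hφ a
    refine ⟨b * x + φ a * u, add_mem (Ideal.mul_mem_left _ _ hx') (Ideal.mul_mem_left _ _ hu), ?_⟩
    rw [smul_eq_mul, map_mul]
    linear_combination x * hb + φ a * hu'

/-- If the ring endomorphism `φ` fixes the generators of an ideal, kills `L` and is the identity
modulo `L`, then `L` is regular modulo the ideal. -/
lemma regularMod_span_of_map_eq_zero [IsDomain A] {φ : A →+* A} {L : A} {G : Set A}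
    (hφ : ∀ a, L ∣ a - φ a) (hG : ∀ g ∈ G, φ g = g) (hL : φ L = 0) (hL0 : L ≠ 0) :
    RegularMod (Ideal.span G) L := by
  intro p hp
  obtain ⟨y, hy, h⟩ := exists_mem_span_sub_map_eq hφ hG hp
  rw [map_mul, hL, zero_mul, sub_zero] at h
  rwa [mul_left_cancel₀ hL0 h]

/-- Applying `φ` to `f q = u + L r` removes `L` and leaves `f (φ q)` in the ideal; moreover `q` and
`φ q` agree modulo `L`. -/
lemma RegularMod.sup_span_of_map_eq {φ : A →+* A} {L f : A} {G : Set A}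
    (hφ : ∀ a, L ∣ a - φ a) (hG : ∀ g ∈ G, φ g = g) (hL : φ L = 0) (hf : φ f = f)
    (hreg : RegularMod (Ideal.span G) f) : RegularMod (Ideal.span G ⊔ Ideal.span {L}) f := by
  intro q hq
  obtain ⟨u, hu, v, hv, huv⟩ := Submodule.mem_sup.1 hq
  obtain ⟨r, rfl⟩ := Ideal.mem_span_singleton.1 hv
  have hle : Ideal.span G ≤ (Ideal.span G).comap φ := by
    rw [Ideal.span_le]
    intro g hg
    change φ g ∈ Ideal.span G
    rw [hG g hg]
    exact Ideal.subset_span hg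
  have h1 : φ q ∈ Ideal.span G := by
    apply hreg
    have := congrArg φ huv
    rw [map_add, map_mul, map_mul, hL, hf, zero_mul, add_zero] at this
    rw [← this]
    exact hle hu
  rw [← add_sub_cancel (φ q) q]
  exact add_mem (Ideal.mem_sup_left h1) (Ideal.mem_sup_right (Ideal.mem_span_singleton.2 (hφ q)))

end Retraction

/-! ### Substitutions for a single variable. -/

/-- The substitution `ξₖ ↦ h`. -/
noncomputable def substXi (n k : ℕ) (h : PolyRing n) : PolyRing n →ₐ[ℂ] PolyRing n :=
  aeval fun i => if i.1 + 1 = k then h else X i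

variable {n : ℕ}

lemma xi_eq_X (i : Fin (n - 1)) : xi n (i + 1) = X i := by
  rw [xi, dif_pos ⟨by omega, by omega⟩]
  rfl

lemma xi_eq_zero {k : ℕ} (hk : ¬(1 ≤ k ∧ k ≤ n - 1)) : xi n k = 0 := dif_neg hk

lemma xi_eq_zero_or_eq_X (n k : ℕ) : xi n k = 0 ∨ ∃ i : Fin (n - 1), i.1 + 1 = k ∧ xi n k = X i := by
  by_cases hk : 1 ≤ k ∧ k ≤ n - 1
  · refine .inr ⟨⟨k - 1, by omega⟩, ?_, ?_⟩
    · simp only; omega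
    · rw [xi, dif_pos hk]
  · exact .inl (xi_eq_zero hk)

lemma substXi_xi_of_ne {j k : ℕ} (hjk : j ≠ k) (h : PolyRing n) :
    substXi n k h (xi n j) = xi n j := by
  rcases xi_eq_zero_or_eq_X n j with h0 | ⟨i, hi, hX⟩
  · rw [h0, map_zero]
  · rw [hX, substXi, aeval_X, if_neg (by omega)]

lemma substXi_xi_self {k : ℕ} (hk : 1 ≤ k ∧ k ≤ n - 1) (h : PolyRing n) :
    substXi n k h (xi n k) = h := by
  rw [xi, dif_pos hk, substXi, aeval_X, if_pos (by simp only; omega)]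

lemma substXi_quad {j k : ℕ} (hjk : j + 1 < k) (h : PolyRing n) :
    substXi n k h (quad n j) = quad n j := by
  have hC (c : ℂ) : substXi n k h (C c) = C c := (substXi n k h).commutes c
  rw [quad, map_mul, map_sub, map_sub, map_mul, map_mul, hC, substXi_xi_of_ne (by omega),
    substXi_xi_of_ne (by omega), substXi_xi_of_ne (by omega)]

lemma dvd_sub_substXi {k : ℕ} (hk : 1 ≤ k ∧ k ≤ n - 1) (h a : PolyRing n) :
    xi n k - h ∣ a - substXi n k h a := by
  rw [← Ideal.mem_span_singleton, ← Ideal.Quotient.mk_eq_mk_iff_sub_mem]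
  have key : Ideal.Quotient.mkₐ ℂ (Ideal.span {xi n k - h}) =
      (Ideal.Quotient.mkₐ ℂ (Ideal.span {xi n k - h})).comp (substXi n k h) := by
    ext i
    rw [AlgHom.comp_apply, ← xi_eq_X]
    by_cases hi : i.1 + 1 = k
    · rw [hi, substXi_xi_self hk]
      exact (Ideal.Quotient.mk_eq_mk_iff_sub_mem _ _).2 (Ideal.mem_span_singleton_self _)
    · rw [substXi_xi_of_ne hi]
  exact DFunLike.congr_fun key a

lemma substXi_xi_sub {k : ℕ} (hk : 1 ≤ k ∧ k ≤ n - 1) {h : PolyRing n}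
    (hh : substXi n k h h = h) : substXi n k h (xi n k - h) = 0 := by
  rw [map_sub, substXi_xi_self hk, hh, sub_self]

/-- The hypothesis says that `h` does not involve `ξ_k`, so `ξ_k ↦ h + 1` sends the difference to
`1`. -/
lemma xi_sub_ne_zero {k : ℕ} (hk : 1 ≤ k ∧ k ≤ n - 1) {h : PolyRing n}
    (hh : ∀ g, substXi n k g h = h) : xi n k - h ≠ 0 := by
  intro h0
  have := congrArg (substXi n k (h + 1)) h0
  rw [map_sub, substXi_xi_self hk, hh, map_zero] at this
  simp at this

lemma regularMod_span_xi_sub {k : ℕ} (hk : 1 ≤ k ∧ k ≤ n - 1) {h : PolyRing n}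
    {G : Set (PolyRing n)} (hh : ∀ g, substXi n k g h = h) (hG : ∀ g ∈ G, substXi n k h g = g) :
    RegularMod (Ideal.span G) (xi n k - h) :=
  regularMod_span_of_map_eq_zero (φ := (substXi n k h).toRingHom) (dvd_sub_substXi hk h) hG
    (substXi_xi_sub hk (hh h)) (xi_sub_ne_zero hk hh)

lemma regularMod_span_xi {k : ℕ} (hk : k < n - 1) :
    RegularMod (Ideal.span ((fun j => xi n (j + 1)) '' Set.Iio k)) (xi n (k + 1)) := by
  rw [← sub_zero (xi n (k + 1))]
  refine regularMod_span_xi_sub ⟨by omega, by omega⟩ (fun _ => map_zero _) ?_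
  rintro _ ⟨j, hj, rfl⟩
  exact substXi_xi_of_ne (by simp only [Set.mem_Iio] at hj; omega) _

/-! ### Regularity of the quadratics. -/

/-- The ideal generated by the first `k` quadratics. -/
noncomputable def partialIdeal (n k : ℕ) : Ideal (PolyRing n) :=
  Ideal.span ((fun j => quad n (j + 1)) '' Set.Iio k)

lemma substXi_eq_of_mem_image_quad {k t : ℕ} (ht : k + 1 < t) (h : PolyRing n) :
    ∀ g ∈ (fun j => quad n (j + 1)) '' Set.Iio k, substXi n t h g = g := by
  rintro _ ⟨j, hj, rfl⟩
  exact substXi_quad (by simp only [Set.mem_Iio] at hj; omega) _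

/-- The quadratic is, up to a unit, `ξₖ₊₁ (ξₖ₊₂ - (2 ξₖ₊₁ - ξₖ))`. -/
lemma quad_succ (n k : ℕ) : quad n (k + 1) =
    C (-1 / 2) * (xi n (k + 1) * (xi n (k + 2) - (C 2 * xi n (k + 1) - xi n k))) := by
  have h1 : (C (-1 / 2) : PolyRing n) = - C (1 / 2) := by rw [← C_neg]; norm_num
  have h2 : (C (1 / 2) * C 2 : PolyRing n) = 1 := by rw [← C_mul]; norm_num
  rw [quad, h1, Nat.add_sub_cancel]
  linear_combination (-xi n (k + 1) ^ 2) * h2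

lemma isUnit_C_of_ne_zero {c : ℂ} (hc : c ≠ 0) : IsUnit (C c : PolyRing n) :=
  (isUnit_iff_ne_zero.2 hc).map C

lemma partialIdeal_succ (n k : ℕ) : partialIdeal n (k + 1) = partialIdeal n k ⊔
    Ideal.span {xi n (k + 1) * (xi n (k + 2) - (C 2 * xi n (k + 1) - xi n k))} := by
  rw [partialIdeal, span_image_Iio_succ, quad_succ,
    Ideal.span_singleton_mul_left_unit (isUnit_C_of_ne_zero (by norm_num))]
  rfl

lemma substXi_two_mul_xi_sub {k t : ℕ} (ht : k + 1 < t) (h : PolyRing n) :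
    substXi n t h (C 2 * xi n (k + 1) - xi n k) = C 2 * xi n (k + 1) - xi n k := by
  have hC : substXi n t h (C 2) = C 2 := (substXi n t h).commutes 2
  rw [map_sub, map_mul, hC, substXi_xi_of_ne (by omega), substXi_xi_of_ne (by omega)]

/-- `(j + 1) ξₖ₊₁ - j ξₖ` is regular modulo the first `k` quadratics. -/
theorem regularMod_partialIdeal_xi_sub {k : ℕ} (hk : k + 1 ≤ n - 1) (j : ℕ) :
    RegularMod (partialIdeal n k) (xi n (k + 1) - C ((j : ℂ) / (j + 1)) * xi n k) := by
  induction k generalizing j with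
  | zero =>
    rw [xi_eq_zero (k := 0) (by omega), mul_zero]
    exact regularMod_span_xi_sub ⟨by omega, hk⟩ (fun _ => map_zero _)
      (by simp)
  | succ k ih =>
    have ih' := ih (by omega)
    have hk2 : 1 ≤ k + 2 ∧ k + 2 ≤ n - 1 := ⟨by omega, hk⟩
    -- The case `j = 0` of the induction hypothesis.
    have hx : RegularMod (partialIdeal n k) (xi n (k + 1)) := by simpa using ih' 0
    have hj : (j : ℂ) + 1 ≠ 0 := by exact_mod_cast j.succ_ne_zero
    have hj2 : (j : ℂ) + 2 ≠ 0 := by exact_mod_cast (j + 1).succ_ne_zero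
    have hC (c : ℂ) (h : PolyRing n) : substXi n (k + 2) h (C c) = C c :=
      (substXi n (k + 2) h).commutes c
    rw [partialIdeal_succ]
    refine hx.sup_span_mul ?_ ?_
    · rw [partialIdeal, ← Ideal.span_union]
      refine regularMod_span_xi_sub hk2 (fun g => ?_) ?_
      · rw [map_mul, hC, substXi_xi_of_ne (by omega)]
      · rintro g (hg | rfl)
        · exact substXi_eq_of_mem_image_quad (by omega) _ g hg
        · exact substXi_xi_of_ne (by omega) _
    -- Modulo `g`, the form becomes `((j+2)/(j+1)) ξ_{k+1} - ξ_k`, that is, `(j+2)/(j+1)` times the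
    -- form for `j + 1`.
    · have hreg := (ih' (j + 1)).sup_span_of_map_eq
        (φ := (substXi n (k + 2) (C 2 * xi n (k + 1) - xi n k)).toRingHom)
        (dvd_sub_substXi hk2 _) (substXi_eq_of_mem_image_quad (by omega) _)
        (substXi_xi_sub hk2 (substXi_two_mul_xi_sub (by omega) _))
        (by
          change substXi n (k + 2) _ _ = _
          rw [map_sub, map_mul, hC, substXi_xi_of_ne (by omega), substXi_xi_of_ne (by omega)])
      refine hreg.of_sub_unit_mul_mem (u := C (((j : ℂ) + 2) / (j + 1)))
        (isUnit_C_of_ne_zero (div_ne_zero hj2 hj)) (Ideal.mem_sup_right ?_)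
      rw [Ideal.mem_span_singleton]
      refine dvd_of_eq ?_
      have h1 : (C (((j : ℂ) + 2) / (j + 1)) * C (((j + 1 : ℕ) : ℂ) / ((j + 1 : ℕ) + 1)) :
          PolyRing n) = 1 := by
        rw [← C_mul, ← C_1]
        congr 1
        push_cast
        rw [add_assoc (j : ℂ) 1 1, one_add_one_eq_two]
        field_simp
      have h2 : (C (((j : ℂ) + 2) / (j + 1)) + C ((j : ℂ) / (j + 1)) : PolyRing n) = C 2 := by
        rw [← C_add]
        congr 1
        field_simp
        ring
      linear_combination xi n (k + 1) * h2 - xi n k * h1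

theorem regularMod_partialIdeal_quad {k : ℕ} (hk : k < n - 1) :
    RegularMod (partialIdeal n k) (quad n (k + 1)) := by
  have hx : RegularMod (partialIdeal n k) (xi n (k + 1)) := by
    simpa using regularMod_partialIdeal_xi_sub (k := k) hk 0
  rcases Nat.lt_or_ge (k + 1) (n - 1) with h | h
  · have hL : RegularMod (partialIdeal n k)
        (xi n (k + 2) - (C 2 * xi n (k + 1) - xi n k)) :=
      regularMod_span_xi_sub ⟨by omega, by omega⟩ (substXi_two_mul_xi_sub (by omega))
        (substXi_eq_of_mem_image_quad (by omega) _)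
    refine (hx.mul hL).of_sub_unit_mul_mem (u := C (-1 / 2))
      (isUnit_C_of_ne_zero (by norm_num)) ?_
    rw [quad_succ, sub_self]
    exact zero_mem _
  -- Here `k + 1 = n - 1`, so `ξ_{k+2} = 0` and the second factor is `ξ_{k+1} - ½ ξ_k`, the case `j
  -- = 1`.
  · have hy := regularMod_partialIdeal_xi_sub (k := k) hk 1
    rw [quad, xi_eq_zero (k := k + 1 + 1) (by omega), mul_zero, sub_zero, Nat.add_sub_cancel]
    refine hx.mul ?_
    convert hy using 4
    norm_num

-- Homogeneity and the Hilbert series.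

attribute [local instance] MvPolynomial.weightedGradedAlgebra

lemma isWeightedHomogeneous_xi (n k : ℕ) : (xi n k).IsWeightedHomogeneous (xiDegree n) 2 := by
  rcases xi_eq_zero_or_eq_X n k with h | ⟨i, -, h⟩
  · rw [h]
    exact isWeightedHomogeneous_zero _ _ _
  · rw [h]
    exact isWeightedHomogeneous_X ℂ (xiDegree n) i

lemma isWeightedHomogeneous_quad (n k : ℕ) :
    (quad n k).IsWeightedHomogeneous (xiDegree n) 4 :=
  (isWeightedHomogeneous_xi n k).mul
    (((isWeightedHomogeneous_xi n k).sub ((isWeightedHomogeneous_xi n _).C_mul _)).sub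
      ((isWeightedHomogeneous_xi n _).C_mul _))

lemma constantCoeff_eq_zero {p : PolyRing n} {i : ℕ} (hi : i ≠ 0)
    (hp : p.IsWeightedHomogeneous (xiDegree n) i) : constantCoeff p = 0 := by
  rw [constantCoeff_eq]
  exact hp.coeff_eq_zero 0 (by simpa using hi.symm)

/-- Generators of positive degree have no constant term. -/
lemma span_image_ne_top {F : ℕ → PolyRing n} {d : ℕ} (hd : d ≠ 0)
    (hF : ∀ k, (F k).IsWeightedHomogeneous (xiDegree n) d) (s : Set ℕ) :
    Ideal.span (F '' s) ≠ ⊤ := by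
  have hle : Ideal.span (F '' s) ≤ RingHom.ker (constantCoeff (σ := Fin (n - 1)) (R := ℂ)) := by
    rw [Ideal.span_le]
    rintro _ ⟨k, -, rfl⟩
    exact constantCoeff_eq_zero hd (hF k)
  intro h
  rw [h] at hle
  have := RingHom.mem_ker.1 (hle (Submodule.mem_top (x := 1)))
  simp at this

lemma finite_weightedHomogeneousSubmodule (n i : ℕ) :
    Module.Finite ℂ (weightedHomogeneousSubmodule ℂ (xiDegree n) i) :=
  Module.Finite.iff_fg.2
    (weightedHomogeneousSubmodule_fg ℂ (xiDegree n) (fun _ => two_ne_zero) i)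

lemma idealJ_eq (n : ℕ) : idealJ n = partialIdeal n (n - 1) := by
  rw [idealJ, partialIdeal]
  congr 1
  ext p
  constructor
  · rintro ⟨k, hk, rfl⟩
    rw [Set.mem_Icc] at hk
    exact ⟨k - 1, by simp only [Set.mem_Iio]; omega, by simp only; rw [Nat.sub_add_cancel hk.1]⟩
  · rintro ⟨k, hk, rfl⟩
    rw [Set.mem_Iio] at hk
    exact ⟨k + 1, ⟨by omega, by omega⟩, rfl⟩

/-- The ideal generated by all the variables. -/
noncomputable def xiIdeal (n : ℕ) : Ideal (PolyRing n) :=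
  Ideal.span ((fun j => xi n (j + 1)) '' Set.Iio (n - 1))

lemma mk_xiIdeal_eq (p : PolyRing n) :
    Ideal.Quotient.mk (xiIdeal n) p = algebraMap ℂ _ (constantCoeff p) := by
  have key : Ideal.Quotient.mkₐ ℂ (xiIdeal n) =
      (Algebra.ofId ℂ (PolyRing n ⧸ xiIdeal n)).comp (aeval fun _ => (0 : ℂ)) := by
    ext i
    rw [AlgHom.comp_apply, aeval_X, map_zero]
    refine Ideal.Quotient.eq_zero_iff_mem.2 (Ideal.subset_span ⟨i, i.2, xi_eq_X i⟩)
  have h := DFunLike.congr_fun key p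
  rw [AlgHom.comp_apply, aeval_zero'] at h
  exact h

lemma hilbertSeries_quotientGrading_xiIdeal (n : ℕ) :
    hilbertSeries (quotientGrading (weightedHomogeneousSubmodule ℂ (xiDegree n)) (xiIdeal n)) =
      1 := by
  have hne : xiIdeal n ≠ ⊤ :=
    span_image_ne_top two_ne_zero (fun k => isWeightedHomogeneous_xi n (k + 1)) _
  have : Nontrivial (PolyRing n ⧸ xiIdeal n) := Ideal.Quotient.nontrivial_iff.2 hne
  ext i
  rw [hilbertSeries, PowerSeries.coeff_mk, PowerSeries.coeff_one]
  split_ifs with hi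
  · subst hi
    have h : quotientGrading (weightedHomogeneousSubmodule ℂ (xiDegree n)) (xiIdeal n) 0 =
        Submodule.span ℂ {1} := by
      apply le_antisymm
      · rintro _ ⟨p, -, rfl⟩
        refine Submodule.mem_span_singleton.2 ⟨constantCoeff p, ?_⟩
        rw [← Algebra.algebraMap_eq_smul_one]
        exact (mk_xiIdeal_eq p).symm
      · rw [Submodule.span_le, Set.singleton_subset_iff]
        simpa using mk_mem_quotientGrading (weightedHomogeneousSubmodule ℂ (xiDegree n))
          (I := xiIdeal n) (isWeightedHomogeneous_one ℂ (xiDegree n))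
    rw [h, finrank_span_singleton one_ne_zero, Nat.cast_one]
  · have h : quotientGrading (weightedHomogeneousSubmodule ℂ (xiDegree n)) (xiIdeal n) i = ⊥ := by
      rw [eq_bot_iff]
      rintro _ ⟨p, hp, rfl⟩
      have := mk_xiIdeal_eq p
      rw [constantCoeff_eq_zero hi hp, map_zero] at this
      exact this
    rw [h, finrank_bot, Nat.cast_zero]

lemma hilbertSeries_quotientPiece (n : ℕ) :
    hilbertSeries (quotientPiece n) = (1 + (PowerSeries.X : PowerSeries ℤ) ^ 2) ^ (n - 1) := by
  have hfin := finite_weightedHomogeneousSubmodule n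
  have hxi := hilbertSeries_quotientGrading_span
    (weightedHomogeneousSubmodule ℂ (xiDegree n)) (F := fun j => xi n (j + 1)) (r := n - 1)
    (fun k _ => isWeightedHomogeneous_xi n (k + 1))
    (fun k hk => (regularMod_span_xi hk).ne_zero
      (span_image_ne_top two_ne_zero (fun j => isWeightedHomogeneous_xi n (j + 1)) _))
    (fun k hk => regularMod_span_xi hk)
  have hquad := hilbertSeries_quotientGrading_span
    (weightedHomogeneousSubmodule ℂ (xiDegree n)) (F := fun j => quad n (j + 1)) (r := n - 1)
    (fun k _ => isWeightedHomogeneous_quad n (k + 1))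
    (fun k hk => (regularMod_partialIdeal_quad hk).ne_zero
      (span_image_ne_top four_ne_zero (fun j => isWeightedHomogeneous_quad n (j + 1)) _))
    (fun k hk => regularMod_partialIdeal_quad hk)
  -- This makes `(1 - s^2)^(n-1)` an inverse of the series of the polynomial ring.
  have hone := hilbertSeries_quotientGrading_xiIdeal n
  rw [xiIdeal, hxi] at hone
  have hpiece : quotientPiece n = quotientGrading (weightedHomogeneousSubmodule ℂ (xiDegree n))
      (idealJ n) := rfl
  rw [hpiece, idealJ_eq, partialIdeal, hquad]
  have hfac : (1 - (PowerSeries.X : PowerSeries ℤ) ^ 4) =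
      (1 + PowerSeries.X ^ 2) * (1 - PowerSeries.X ^ 2) := by ring
  rw [hfac, mul_pow, mul_assoc, hone, mul_one]

/-! ### Translation to `RingTheory.Sequence.IsRegular`. -/

lemma length_quadSeq (n : ℕ) : (quadSeq n).length = n - 1 := List.length_ofFn

lemma getElem_quadSeq {i : ℕ} (hi : i < (quadSeq n).length) :
    (quadSeq n)[i] = quad n (i + 1) := by
  simp [quadSeq]

lemma ofList_take_quadSeq {k : ℕ} (hk : k ≤ n - 1) :
    Ideal.ofList ((quadSeq n).take k) = partialIdeal n k := by
  rw [Ideal.ofList, partialIdeal]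
  congr 1
  ext p
  simp only [Set.mem_ofPred_eq, List.mem_take_iff_getElem, getElem_quadSeq, length_quadSeq,
    Set.mem_image, Set.mem_Iio, min_eq_left hk, exists_prop]

lemma isRegular_quadSeq (n : ℕ) : RingTheory.Sequence.IsRegular (PolyRing n) (quadSeq n) where
  regular_mod_prev := by
    intro i hi
    have hi' : i < n - 1 := by rwa [length_quadSeq] at hi
    rw [getElem_quadSeq, ofList_take_quadSeq hi'.le, isSMulRegular_iff_right_eq_zero_of_smul]
    intro q hq
    obtain ⟨p, rfl⟩ := Submodule.Quotient.mk_surjective _ q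
    rw [← Submodule.Quotient.mk_smul, Submodule.Quotient.mk_eq_zero, smul_eq_mul, smul_eq_mul,
      Ideal.mul_top] at hq
    rw [Submodule.Quotient.mk_eq_zero, smul_eq_mul, Ideal.mul_top]
    exact regularMod_partialIdeal_quad hi' p hq
  top_ne_smul := by
    have h := ofList_take_quadSeq (n := n) le_rfl
    rw [List.take_of_length_le (length_quadSeq n).le] at h
    rw [h, smul_eq_mul, Ideal.mul_top]
    exact (span_image_ne_top four_ne_zero
      (fun j => isWeightedHomogeneous_quad n (j + 1)) _).symm

lemma isHomogeneous_idealJ (n : ℕ) :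
    (idealJ n).IsHomogeneous (weightedHomogeneousSubmodule ℂ (xiDegree n)) := by
  rw [idealJ_eq]
  exact isHomogeneous_span_image_Iio _ fun k _ => isWeightedHomogeneous_quad n (k + 1)

end Peterson

theorem lemma4p1 (n : ℕ) (hn : 2 ≤ n) :
    -- the quotient is a graded algebra with finite-dimensional pieces, and its Hilbert series
    (Nonempty (GradedAlgebra (Peterson.quotientPiece n)) ∧
      (∀ i, Module.Finite ℂ (Peterson.quotientPiece n i)) ∧
      Peterson.hilbertSeries (Peterson.quotientPiece n) =
        (1 + (PowerSeries.X : PowerSeries ℤ) ^ 2) ^ (n - 1)) ∧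
    -- the quadratics are homogeneous of positive degree and form a regular sequence
    ((∀ k ∈ Set.Icc 1 (n - 1),
        (Peterson.quad n k).IsWeightedHomogeneous (Peterson.xiDegree n) 4) ∧
      RingTheory.Sequence.IsRegular (Peterson.PolyRing n) (Peterson.quadSeq n)) := by
  let _ : GradedAlgebra (weightedHomogeneousSubmodule ℂ (Peterson.xiDegree n)) :=
    weightedGradedAlgebra ℂ (Peterson.xiDegree n)
  refine ⟨⟨Peterson.nonempty_gradedAlgebra_quotientGrading _ (Peterson.isHomogeneous_idealJ n),
    fun i => ?_, Peterson.hilbertSeries_quotientPiece n⟩,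
    fun k _ => Peterson.isWeightedHomogeneous_quad n k, Peterson.isRegular_quadSeq n⟩
  have := Peterson.finite_weightedHomogeneousSubmodule n i
  exact Module.Finite.map _ _
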